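/- **Setting.** Let $m\ge 2$ and let $C=[m]$ be a set of experts. A *ranking distribution* is a probability distribution $P$ on the strict rankings (permutations) $\pi$ of $C$; $\mathrm{rank}_\pi(c)\in\{1,\dots,m\}$ is the position of $c$ in $\pi$, rank $1$ being best. For nonempty $S\subseteq C$ put $r_\pi(S)=\min_{c\in S}\mathrm{rank}_\pi(c)$. For nonempty $S\subsetneq C$ let $$\theta_P(S)=\min_{x\in C\setminus S}\Pr_{\pi\sim P}\big[r_\pi(S)<\mathrm{rank}_\pi(x)\big],\qquad \theta_1^*(P)=\max_{c\in C}\theta_P(\{c\}).$$ An *adaptive algorithm* has access to tasks whose latent rankings $\pi_0,\pi_1,\pi_2,\dots$ are i.i.d. from an unknown $P$, and knows $m$ and $\varepsilon$ (and $s$ in (i)). It may use internal randomness independent of the tasks. In each step, based on its internal randomness and on the answers received so far, it either makes a pairwise query $(t,a,b)$, with $t\ge 0$ and distinct $a,b\in C$, and learns whether $\mathrm{rank}_{\pi_t}(a)<\mathrm{rank}_{\pi_t}(b)$, or stops and returns an output. It gets no other information about $P$ or the rankings; drawing tasks is free, and the same task may be queried any number of times. Let $Q\in\{0,1,2,\dots\}\cup\{\infty\}$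 be the total number of queries made. The *worst-case expected pairwise query complexity* of the algorithm is $\sup_P\mathbb E_P[Q]\in[0,\infty]$, over all ranking distributions $P$ on $C$. **Theorem.** There is a universal constant $\kappa>0$ such that for all integers $m\ge2$ and all real $0<\varepsilon\le 1/16$ the following hold. (i) Let $s\in C$. Suppose that an adaptive algorithm, for every ranking distribution $P$, with probability at least $2/3$ stops and returns a real number $\widehat\theta$ with $|\widehat\theta-\theta_P(\{s\})|\le\varepsilon$. Then its worst-case expected pairwise query complexity is at least $\kappa\,(m-1)/\varepsilon^2$. (ii) Suppose that an adaptive algorithm, for every ranking distribution $P$, with probability at least $2/3$ stops and returns an expert $\widehat c\in C$ with $\theta_P(\{\widehat c\})\ge\theta_1^*(P)-\varepsilon$. Then its worst-case expected pairwise query complexity is at least $\kappa\,m/\varepsilon^2$. -/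

import Mathlib

open MeasureTheory
open scoped ENNReal

namespace PairwiseFeedback

/-- A strict ranking of the experts `Fin m`: the permutation `π` sends an expert to its position,
position `0` being the best. -/
abbrev Ranking (m : ℕ) : Type := Equiv.Perm (Fin m)

/-- The finite set of rankings carries the discrete σ-algebra. -/
instance instMeasurableSpaceRanking (m : ℕ) : MeasurableSpace (Ranking m) := ⊤

/-- The rank of expert `c`, a number in `{1, …, m}`; rank `1` is best. -/
def rank {m : ℕ} (π : Ranking m) (c : Fin m) : ℕ := (π c : ℕ) + 1

/-- The rank of the best member of a committee; the empty committee has rank `m + 1`. -/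
def bestRank {m : ℕ} (π : Ranking m) (S : Finset (Fin m)) : ℕ :=
  if h : S.Nonempty then S.inf' h (rank π) else m + 1

/-- The probability that committee `S` beats committee `S'` on a random ranking with law `P`,
ties counting one half. -/
noncomputable def win {m : ℕ} (P : PMF (Ranking m)) (S S' : Finset (Fin m)) : ℝ :=
  ∑ π : Ranking m, (P π).toReal *
    ((if bestRank π S < bestRank π S' then 1 else 0) +
      (1 / 2) * (if bestRank π S = bestRank π S' then 1 else 0))

/-- `θ(S)`, the minimum over outside experts `x ∉ S` of the win rate of `S` against `{x}`
(an infimum over a finite set, which is nonempty when `S` is a proper committee). -/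
noncomputable def theta {m : ℕ} (P : PMF (Ranking m)) (S : Finset (Fin m)) : ℝ :=
  ⨅ x : {x : Fin m // x ∉ S}, win P S {(x : Fin m)}

/-- `θ_k^*`, the maximum of `θ` over the committees of size `k` (meant for `1 ≤ k < m`). -/
noncomputable def thetaStar {m : ℕ} (P : PMF (Ranking m)) (k : ℕ) : ℝ :=
  ⨆ S : {S : Finset (Fin m) // S.card = k}, theta P (S : Finset (Fin m))

/-- A pairwise query: the handle `t` of a sampled task (the `t`-th one drawn), and an ordered pair
of distinct experts. -/
abbrev PairQuery (m : ℕ) : Type := ℕ × {p : Fin m × Fin m // p.1 ≠ p.2}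

/-- The oracle's answer when `π t` is the latent ranking of the `t`-th sampled task: whether the
first expert is ranked above the second one. -/
def answer {m : ℕ} (π : ℕ → Ranking m) (q : PairQuery m) : Bool :=
  decide (rank (π q.1) q.2.1.1 < rank (π q.1) q.2.1.2)

/-- An adaptive randomized algorithm with pairwise query access and outputs in `Out`.
Its internal randomness is a seed from an arbitrary probability space. Given the seed and the
answers received so far (most recent first; the queries asked so far are determined by these), it
either asks one more query, about any sampled task, old or new, or stops and returns an output. -/
structure Algorithm (m : ℕ) (Out : Type) [MeasurableSpace Out] where
  Seed : Type*
  [measurableSpaceSeed : MeasurableSpace Seed]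
  seedLaw : Measure Seed
  [isProbabilityMeasure_seedLaw : IsProbabilityMeasure seedLaw]
  act : Seed → List Bool → PairQuery m ⊕ Out
  measurable_act : ∀ h : List Bool, Measurable fun ω => act ω h

namespace Algorithm

attribute [instance] measurableSpaceSeed isProbabilityMeasure_seedLaw

variable {m : ℕ} {Out : Type} [MeasurableSpace Out]

/-- The answers received in the first `n` steps, given the seed `ω` and the latent rankings `π` of
the sampled tasks; nothing changes any more once the algorithm has stopped. -/
def history (A : Algorithm m Out) (ω : A.Seed) (π : ℕ → Ranking m) : ℕ → List Bool
  | 0 => []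
  | n + 1 =>
    match A.act ω (A.history ω π n) with
    | Sum.inl q => answer π q :: A.history ω π n
    | Sum.inr _ => A.history ω π n

/-- The algorithm stops and returns `y`. -/
def Returns (A : Algorithm m Out) (ω : A.Seed) (π : ℕ → Ranking m) (y : Out) : Prop :=
  ∃ n, A.act ω (A.history ω π n) = Sum.inr y

/-- The total number of oracle calls, which is `∞` if the algorithm never stops. -/
noncomputable def numQueries (A : Algorithm m Out) (ω : A.Seed) (π : ℕ → Ranking m) : ℝ≥0∞ :=
  ⨆ n, ((A.history ω π n).length : ℝ≥0∞)

/-- The joint law of the seed and of the latent rankings: the rankings are i.i.d. with law `P`, and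
independent of the seed. -/
noncomputable def runLaw (A : Algorithm m Out) (P : PMF (Ranking m)) :
    Measure (A.Seed × (ℕ → Ranking m)) :=
  A.seedLaw.prod (Measure.infinitePi fun _ : ℕ => P.toMeasure)

/-- The probability, on ranking distribution `P`, that the algorithm stops and returns an element
of `G`. -/
noncomputable def successProb (A : Algorithm m Out) (P : PMF (Ranking m)) (G : Set Out) : ℝ≥0∞ :=
  A.runLaw P {z | ∃ y ∈ G, A.Returns z.1 z.2 y}

/-- The expected number of pairwise queries on ranking distribution `P`. -/
noncomputable def expectedQueries (A : Algorithm m Out) (P : PMF (Ranking m)) : ℝ≥0∞ :=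
  ∫⁻ z, A.numQueries z.1 z.2 ∂(A.runLaw P)

/-- The worst-case expected number of pairwise queries over all ranking distributions. -/
noncomputable def worstCaseExpectedQueries (A : Algorithm m Out) : ℝ≥0∞ :=
  ⨆ P : PMF (Ranking m), A.expectedQueries P

end Algorithm

end PairwiseFeedback

namespace PairwiseFeedback

/-! The lower bound compares one unbiased instance with instances in which a single expert is
better. In each task every expert is independently good or bad; good experts precede bad ones, and
ties follow the index order or its reverse according to a fair orientation bit. Then `a` beats `b`
with probability `1/2 + (q a - q b)/2` (`win_instanceLaw`). With all quality bits fair, every single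
expert has `θ = 1/2`. Raising the bias of `c` to `1/2 + 5ε` lifts `θ({c})` to `1/2 + 5ε/2` and
pushes every other `θ({s})` to at most `1/2 - 5ε/2`. A correct algorithm must react to this for
nearly every `c`.

A query reads the orientation bit and two quality bits of one task, so only queries involving `c`
carry information about the bias of `c`. For a fixed seed, a run cut off after `n` such queries is a
decision tree reading at most `n` biased bits (`reads_iterate_step`). A second-moment bound loses a
factor `1 + 4δ²` per biased bit (`Reads.sq_integral_le`), so for `n` of order `1/ε²` the probability
of an event changes by at most `1/12` (`Reads.integral_le_add`).

An output event of probability at least `1/2` on the unbiased instance and at most `1/3` on the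
raised one has a gap of `1/6`. Half of it is left for runs with more than `n` queries on `c`, so by
Markov's inequality the unbiased instance needs order `1/ε²` expected queries on `c`
(`le_lintegral_numQueriesOn`). Summing over all experts but one, with each query counted twice,
gives order `(m - 1)/ε²` (`le_expectedQueries_baseBias`). The exempt expert is `s` in (i), and in
(ii) the one output, if any, that the unbiased instance returns with probability above `1/2`. -/

/-- The law of a bit that is `true` with probability `q`. -/
noncomputable def bitLaw (q : unitInterval) : Measure Bool :=
  ENNReal.ofReal q • Measure.dirac true + ENNReal.ofReal (1 - q) • Measure.dirac false

instance isProbabilityMeasure_bitLaw (q : unitInterval) : IsProbabilityMeasure (bitLaw q) := by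
  constructor
  have h0 := q.2.1
  have h1 := q.2.2
  simp only [bitLaw, Measure.coe_add, Measure.coe_smul, Pi.add_apply, Pi.smul_apply, measure_univ,
    smul_eq_mul, mul_one]
  rw [← ENNReal.ofReal_add h0 (by linarith)]
  simp

lemma integral_bitLaw (q : unitInterval) (g : Bool → ℝ) :
    ∫ v, g v ∂bitLaw q = q * g true + (1 - q) * g false := by
  have h0 := q.2.1
  have h1 := q.2.2
  have h (v : Bool) (r : ℝ) : Integrable g (ENNReal.ofReal r • Measure.dirac v) :=
    Integrable.of_finite.smul_measure ENNReal.ofReal_ne_top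
  rw [bitLaw, integral_add_measure (h _ _) (h _ _), integral_smul_measure, integral_smul_measure, integral_dirac, integral_dirac,
    ENNReal.toReal_ofReal h0, ENNReal.toReal_ofReal (by linarith)]
  simp

/-! ### Independent bits, decision trees and change of bias -/

section Bits

variable {ι : Type*} [DecidableEq ι]

/-- The law of independent bits with prescribed success probabilities. -/
noncomputable def bitsLaw (q : ι → unitInterval) : Measure (ι → Bool) :=
  Measure.infinitePi fun i => bitLaw (q i)

instance isProbabilityMeasure_bitsLaw (q : ι → unitInterval) :
    IsProbabilityMeasure (bitsLaw q) := by
  unfold bitsLaw; infer_instance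

lemma measurable_update_pair (i : ι) :
    Measurable fun p : Bool × (ι → Bool) => Function.update p.2 i p.1 := by
  refine measurable_pi_iff.2 fun j => ?_
  by_cases h : j = i
  · subst h; simpa using measurable_fst
  · simpa [Function.update_of_ne h, Function.comp_def] using
      (measurable_pi_apply j).comp measurable_snd

/-- Resampling one coordinate of a product measure preserves it. This allows conditioning on a bit
by `Function.update`, without splitting the index set, so that subtrees remain functions of all the
bits. -/
lemma map_update_bitsLaw (q : ι → unitInterval) (i : ι) :
    ((bitLaw (q i)).prod (bitsLaw q)).map
      (fun p : Bool × (ι → Bool) => Function.update p.2 i p.1) = bitsLaw q := by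
  refine Measure.eq_infinitePi _ fun s t ht => ?_
  rw [Measure.map_apply (measurable_update_pair i) (.pi s.countable_toSet fun _ _ => ht _)]
  by_cases hi : i ∈ s
  · have : (fun p : Bool × (ι → Bool) => Function.update p.2 i p.1) ⁻¹' (Set.pi s t) =
        t i ×ˢ Set.pi (s.erase i : Finset ι) t := by
      ext p
      simp only [Set.mem_preimage, Set.mem_pi, Set.mem_prod, Finset.mem_coe, Finset.mem_erase]
      constructor
      · intro h
        refine ⟨by simpa using h i hi, fun j hj => ?_⟩
        simpa [Function.update_of_ne hj.1] using h j hj.2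
      · rintro ⟨h1, h2⟩ j hj
        by_cases hji : j = i
        · subst hji; simpa using h1
        · simpa [Function.update_of_ne hji] using h2 j ⟨hji, hj⟩
    rw [this, Measure.prod_prod, bitsLaw, Measure.infinitePi_pi _ fun j _ => ht j,
      Finset.mul_prod_erase s (fun j => bitLaw (q j) (t j)) hi]
  · have : (fun p : Bool × (ι → Bool) => Function.update p.2 i p.1) ⁻¹' (Set.pi s t) =
        Set.univ ×ˢ Set.pi s t := by
      ext p
      simp only [Set.mem_preimage, Set.mem_pi, Set.mem_prod, Finset.mem_coe, Set.mem_univ, true_and]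
      refine forall₂_congr fun j hj => ?_
      have hji : j ≠ i := fun h => hi (h ▸ hj)
      simp [Function.update_of_ne hji]
    rw [this, Measure.prod_prod, bitsLaw, Measure.infinitePi_pi _ fun j _ => ht j, measure_univ,
      one_mul]

lemma integral_bitsLaw_update (q : ι → unitInterval) (i : ι) {f : (ι → Bool) → ℝ}
    (hf : Integrable f (bitsLaw q)) :
    ∫ b, f b ∂bitsLaw q = q i * ∫ b, f (Function.update b i true) ∂bitsLaw q +
      (1 - q i) * ∫ b, f (Function.update b i false) ∂bitsLaw q := by
  have hm := (measurable_update_pair (ι := ι) i).aemeasurable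
    (μ := (bitLaw (q i)).prod (bitsLaw q))
  have hf' : Integrable f (((bitLaw (q i)).prod (bitsLaw q)).map
      (fun p : Bool × (ι → Bool) => Function.update p.2 i p.1)) := by
    rwa [map_update_bitsLaw]
  conv_lhs => rw [← map_update_bitsLaw q i]
  rw [integral_map hm hf'.aestronglyMeasurable,
    integral_prod (fun p : Bool × (ι → Bool) => f (Function.update p.2 i p.1))
      ((integrable_map_measure hf'.aestronglyMeasurable hm).1 hf'), integral_bitLaw]

/-- `Reads C n f`: the function `f` of the bits is computed by a decision tree which on every
branch reads at most `n` bits in `C`. -/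
inductive Reads (C : Set ι) : ℕ → ((ι → Bool) → ℝ) → Prop
  | const (n : ℕ) (a : ℝ) : Reads C n fun _ => a
  | free (n : ℕ) (i : ι) (f : (ι → Bool) → ℝ) (hi : i ∉ C)
      (h : ∀ v, Reads C n fun b => f (Function.update b i v)) : Reads C n f
  | paid (n : ℕ) (i : ι) (f : (ι → Bool) → ℝ) (hi : i ∈ C)
      (h : ∀ v, Reads C n fun b => f (Function.update b i v)) : Reads C (n + 1) f

namespace Reads

variable {C : Set ι} {n : ℕ} {f : (ι → Bool) → ℝ}

lemma comp_update (h : Reads C n f) (i : ι) (v : Bool) :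
    Reads C n fun b => f (Function.update b i v) := by
  have key : ∀ (g : (ι → Bool) → ℝ) (j : ι) (n : ℕ),
      (∀ w, Reads C n fun b => g (Function.update (Function.update b i v) j w)) →
      (∀ w, Reads C n fun b => g (Function.update b j w)) →
      ∀ w, Reads C n fun b => g (Function.update (Function.update b j w) i v) := by
    intro g j n h1 h2 w
    by_cases hij : i = j
    · subst hij
      simpa [Function.update_idem] using h2 v
    · simpa only [Function.update_comm hij] using h1 w
  induction h with
  | const n a => exact const n a
  | free n j g hj h ih => exact free n j _ hj (key g j n ih h)
  | paid n j g hj h ih => exact paid n j _ hj (key g j n ih h)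

lemma comp (h : Reads C n f) (φ : ℝ → ℝ) : Reads C n fun b => φ (f b) := by
  induction h with
  | const n a => exact const n _
  | free n j g hj h ih => exact free n j _ hj ih
  | paid n j g hj h ih => exact paid n j _ hj ih

/-- Branching on a bit on which the subtrees may depend again: `comp_update` substitutes the known
value there. -/
lemma read_free {i : ι} (hi : i ∉ C) {F : Bool → (ι → Bool) → ℝ} (h : ∀ v, Reads C n (F v)) :
    Reads C n fun b => F (b i) b :=
  free n i _ hi fun v => by simpa using (h v).comp_update i v

lemma read_paid {i : ι} (hi : i ∈ C) {F : Bool → (ι → Bool) → ℝ} (h : ∀ v, Reads C n (F v)) :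
    Reads C (n + 1) fun b => F (b i) b :=
  paid n i _ hi fun v => by simpa using (h v).comp_update i v

lemma measurable_bounded (h : Reads C n f) : Measurable f ∧ ∃ M, ∀ b, |f b| ≤ M := by
  have key : ∀ (g : (ι → Bool) → ℝ) (i : ι),
      (∀ v, (Measurable fun b => g (Function.update b i v)) ∧
        ∃ M, ∀ b, |g (Function.update b i v)| ≤ M) → Measurable g ∧ ∃ M, ∀ b, |g b| ≤ M := by
    intro g i h
    have hg : g = fun b => if b i = true then g (Function.update b i true)
        else g (Function.update b i false) := by
      funext b
      cases hb : b i <;> simp [← hb]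
    obtain ⟨M1, hM1⟩ := (h true).2
    obtain ⟨M0, hM0⟩ := (h false).2
    refine ⟨?_, max M1 M0, fun b => ?_⟩
    · rw [hg]
      have hi : MeasurableSet {b : ι → Bool | b i = true} :=
        (measurable_pi_apply i : Measurable fun b : ι → Bool => b i) (measurableSet_singleton true)
      exact Measurable.ite hi (h true).1 (h false).1
    · rw [hg]
      dsimp only
      split_ifs
      · exact (hM1 b).trans (le_max_left _ _)
      · exact (hM0 b).trans (le_max_right _ _)
  induction h with
  | const n a => exact ⟨measurable_const, |a|, fun _ => le_rfl⟩
  | free n i g hi h ih => exact key g i ih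
  | paid n i g hi h ih => exact key g i ih

lemma integrable (h : Reads C n f) (μ : Measure (ι → Bool)) [IsFiniteMeasure μ] :
    Integrable f μ := by
  obtain ⟨hm, M, hM⟩ := h.measurable_bounded
  exact Integrable.of_bound hm.aestronglyMeasurable M (Filter.Eventually.of_forall hM)

/-- Changing the bias of the bits in `C` from `1 / 2` to `1 / 2 + δ` costs a factor `1 + 4 δ ^ 2`
in second moment for each of these bits that is read. -/
lemma sq_integral_le (h : Reads C n f) {q q₀ : ι → unitInterval} {δ : ℝ}
    (hfree : ∀ i ∉ C, q i = q₀ i) (hC₀ : ∀ i ∈ C, (q₀ i : ℝ) = 1 / 2)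
    (hC : ∀ i ∈ C, (q i : ℝ) = 1 / 2 + δ) :
    (∫ b, f b ∂bitsLaw q) ^ 2 ≤ (1 + 4 * δ ^ 2) ^ n * ∫ b, f b ^ 2 ∂bitsLaw q₀ := by
  induction h with
  | const n a =>
    have : 1 ≤ (1 + 4 * δ ^ 2) ^ n := one_le_pow₀ (by nlinarith [sq_nonneg δ])
    simp only [integral_const, probReal_univ, smul_eq_mul, one_mul]
    nlinarith [sq_nonneg a]
  | free n i g hi h ih =>
    have hg : Reads C n g := free n i g hi h
    rw [integral_bitsLaw_update q i (hg.integrable _),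
      integral_bitsLaw_update q₀ i ((hg.comp (· ^ 2)).integrable _), ← hfree i hi]
    have h1 := ih true
    have h0 := ih false
    dsimp only at h1 h0
    have hq0 := (q i).2.1
    have hq1 : (0 : ℝ) ≤ 1 - q i := by linarith [(q i).2.2]
    set u : ℝ := (q i : ℝ)
    set X := ∫ b, g (Function.update b i true) ∂bitsLaw q
    set Y := ∫ b, g (Function.update b i false) ∂bitsLaw q
    -- Convexity of the square; both laws give this bit the same weights, so nothing is lost.
    nlinarith [mul_le_mul_of_nonneg_left h1 hq0, mul_le_mul_of_nonneg_left h0 hq1,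
      mul_nonneg (mul_nonneg hq0 hq1) (sq_nonneg (X - Y))]
  | paid n i g hi h ih =>
    have hg : Reads C (n + 1) g := paid n i g hi h
    rw [integral_bitsLaw_update q i (hg.integrable _),
      integral_bitsLaw_update q₀ i ((hg.comp (· ^ 2)).integrable _), hC i hi, hC₀ i hi]
    have h1 := ih true
    have h0 := ih false
    dsimp only at h1 h0
    set X := ∫ b, g (Function.update b i true) ∂bitsLaw q
    set Y := ∫ b, g (Function.update b i false) ∂bitsLaw q
    have hδ : 0 ≤ 1 + 4 * δ ^ 2 := by positivity
    -- Cauchy–Schwarz, with `(1/2 + δ)² + (1/2 - δ)² = (1 + 4δ²)/2`.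
    have hXY : ((1 / 2 + δ) * X + (1 - (1 / 2 + δ)) * Y) ^ 2 ≤
        (1 + 4 * δ ^ 2) * ((X ^ 2 + Y ^ 2) / 2) := by
      nlinarith [sq_nonneg ((1 / 2 + δ) * Y - (1 / 2 - δ) * X)]
    refine hXY.trans ?_
    rw [pow_succ' _ n, mul_assoc]
    refine mul_le_mul_of_nonneg_left ?_ hδ
    linarith

/-- An event decided with few reads of bits in `C` has almost the same probability under both
biases. -/
lemma integral_le_add (h : Reads C n f) (hf : ∀ b, f b = 0 ∨ f b = 1) {q q₀ : ι → unitInterval}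
    {δ : ℝ} (hfree : ∀ i ∉ C, q i = q₀ i) (hC₀ : ∀ i ∈ C, (q₀ i : ℝ) = 1 / 2)
    (hC : ∀ i ∈ C, (q i : ℝ) = 1 / 2 + δ) (hn : (1 + 4 * δ ^ 2) ^ n ≤ 201 / 200) :
    ∫ b, f b ∂bitsLaw q₀ ≤ ∫ b, f b ∂bitsLaw q + 1 / 12 := by
  set x := ∫ b, f b ∂bitsLaw q with hx
  set y := ∫ b, f b ∂bitsLaw q₀ with hy
  have hy0 : 0 ≤ y := integral_nonneg fun b => by rcases hf b with h | h <;> simp [h]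
  have hy1 : y ≤ 1 := by
    have := integral_mono (h.integrable (bitsLaw q₀)) (integrable_const 1)
      (fun b => by rcases hf b with h | h <;> simp [h])
    simpa using this
  -- The second-moment bound is applied to every shift `f - a`; the unshifted bound alone would not
  -- make `x` and `y` close.
  have key : ∀ a : ℝ, (x - a) ^ 2 ≤ 201 / 200 * (y * (1 - 2 * a) + a ^ 2) := by
    intro a
    have h1 := (h.comp (· - a)).sq_integral_le hfree hC₀ hC
    have h2 : ∫ b, (f b - a) ∂bitsLaw q = x - a := by
      rw [integral_sub (h.integrable _) (integrable_const a)]; simp [hx]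
    have h3 : ∫ b, (f b - a) ^ 2 ∂bitsLaw q₀ = y * (1 - 2 * a) + a ^ 2 := by
      have : (fun b => (f b - a) ^ 2) = fun b => f b * (1 - 2 * a) + a ^ 2 := by
        funext b
        rcases hf b with h | h <;> rw [h] <;> ring
      rw [this, integral_add ((h.integrable _).mul_const _) (integrable_const _),
        integral_mul_const]
      simp [hy]
    have h4 : 0 ≤ ∫ b, (f b - a) ^ 2 ∂bitsLaw q₀ := integral_nonneg fun b => sq_nonneg _
    rw [h2] at h1
    refine h1.trans ((mul_le_mul_of_nonneg_right hn h4).trans_eq ?_)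
    rw [h3]
  -- With `l = 201/200`, this `a = (l y - x)/(l - 1)` is the optimal shift. It yields `(l y - x)² ≤
  -- (l - 1)(l y - x²) ≤ 201/40000`, hence `y - x < 1/12`.
  have hD := key (200 * (201 / 200 * y - x))
  by_contra! hlt
  nlinarith [sq_nonneg x]

end Reads

end Bits

/-! ### Integrals of functions of one, two or three bits -/

section FiniteBits

variable {ι : Type*} [DecidableEq ι] [Finite ι]

lemma integral_one_bit (q : ι → unitInterval) (k : ι) (g : Bool → ℝ) :
    ∫ b, g (b k) ∂bitsLaw q = q k * g true + (1 - q k) * g false := by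
  rw [integral_bitsLaw_update q k Integrable.of_finite]
  simp

lemma integral_two_bits (q : ι → unitInterval) {j k : ι} (hjk : j ≠ k) (g : Bool → Bool → ℝ) :
    ∫ b, g (b j) (b k) ∂bitsLaw q =
      q j * (q k * g true true + (1 - q k) * g true false) +
      (1 - q j) * (q k * g false true + (1 - q k) * g false false) := by
  rw [integral_bitsLaw_update q j Integrable.of_finite]
  simp only [Function.update_self, Function.update_of_ne hjk.symm]
  rw [integral_one_bit q k (g true), integral_one_bit q k (g false)]

lemma integral_three_bits (q : ι → unitInterval) {i j k : ι} (hij : i ≠ j) (hik : i ≠ k)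
    (hjk : j ≠ k) (g : Bool → Bool → Bool → ℝ) :
    ∫ b, g (b i) (b j) (b k) ∂bitsLaw q =
      q i * (q j * (q k * g true true true + (1 - q k) * g true true false) +
        (1 - q j) * (q k * g true false true + (1 - q k) * g true false false)) +
      (1 - q i) * (q j * (q k * g false true true + (1 - q k) * g false true false) +
        (1 - q j) * (q k * g false false true + (1 - q k) * g false false false)) := by
  rw [integral_bitsLaw_update q i Integrable.of_finite]
  simp only [Function.update_self, Function.update_of_ne hij.symm, Function.update_of_ne hik.symm]
  rw [integral_two_bits q hjk (g true), integral_two_bits q hjk (g false)]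

end FiniteBits

/-! ### The hard instances and their win rates -/

section Instances

variable {m : ℕ}

/-- The position key of expert `x`: good experts come first, and equally good ones are ordered by
their index or in reverse, depending on the orientation bit `r`. -/
def positionKey (x : Fin m) (r u : Bool) : ℕ :=
  (if u then 0 else m) + (if r then (x : ℕ) else m - 1 - x)

lemma positionKey_injective (β : Option (Fin m) → Bool) :
    Function.Injective fun x : Fin m => positionKey x (β none) (β (some x)) := by
  intro x y h
  have hx := x.2
  have hy := y.2
  simp only [positionKey] at h
  ext
  split_ifs at h <;> omega

/-- The ranking determined by an orientation bit and one quality bit for each expert. -/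
noncomputable def rankingOf (β : Option (Fin m) → Bool) : Ranking m :=
  Equiv.ofBijective
    (fun x => ⟨(Finset.univ.filter fun y : Fin m =>
        positionKey y (β none) (β (some y)) < positionKey x (β none) (β (some x))).card,
      (Finset.card_lt_univ_of_notMem (x := x) (by simp)).trans_eq (Fintype.card_fin m)⟩)
    (Finite.injective_iff_bijective.1 (by
      have key : ∀ x y : Fin m,
          positionKey x (β none) (β (some x)) < positionKey y (β none) (β (some y)) →
          (Finset.univ.filter fun z : Fin m =>
            positionKey z (β none) (β (some z)) < positionKey x (β none) (β (some x))).card <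
          (Finset.univ.filter fun z : Fin m =>
            positionKey z (β none) (β (some z)) < positionKey y (β none) (β (some y))).card := by
        intro x y h
        refine Finset.card_lt_card (Finset.ssubset_iff_of_subset ?_ |>.2 ⟨x, ?_, ?_⟩)
        · intro z hz
          simp only [Finset.mem_filter, Finset.mem_univ, true_and] at hz ⊢
          exact hz.trans h
        · simpa using h
        · simp
      intro x y h
      simp only [Fin.mk.injEq] at h
      rcases lt_trichotomy (positionKey x (β none) (β (some x)))
        (positionKey y (β none) (β (some y))) with h' | h' | h'
      · exact absurd h (key x y h').ne
      · exact positionKey_injective β h'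
      · exact absurd h (key y x h').ne'))

lemma rank_rankingOf_lt_iff (β : Option (Fin m) → Bool) (a b : Fin m) :
    rank (rankingOf β) a < rank (rankingOf β) b ↔
      positionKey a (β none) (β (some a)) < positionKey b (β none) (β (some b)) := by
  have key : ∀ x y : Fin m,
      positionKey x (β none) (β (some x)) ≤ positionKey y (β none) (β (some y)) →
      rank (rankingOf β) x ≤ rank (rankingOf β) y := by
    intro x y h
    have hsub : (Finset.univ.filter fun z : Fin m =>
          positionKey z (β none) (β (some z)) < positionKey x (β none) (β (some x))) ⊆
        Finset.univ.filter fun z : Fin m =>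
          positionKey z (β none) (β (some z)) < positionKey y (β none) (β (some y)) := by
      intro z hz
      simp only [Finset.mem_filter, Finset.mem_univ, true_and] at hz ⊢
      exact hz.trans_le h
    exact Nat.succ_le_succ (Finset.card_le_card hsub)
  constructor
  · intro h
    by_contra! hle
    exact absurd (key b a hle) h.not_ge
  · intro h
    refine lt_of_le_of_ne (key a b h.le) fun he => ?_
    have hab : a = b := (rankingOf β).injective (Fin.ext (Nat.succ_injective he))
    subst hab
    exact lt_irrefl _ h

lemma measurable_rankingOf : Measurable (rankingOf (m := m)) := Measurable.of_discrete

/-- The law of the ranking of independent quality bits and an independent orientation bit. -/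
noncomputable def instanceLaw (q : Option (Fin m) → unitInterval) : PMF (Ranking m) :=
  haveI := Measure.isProbabilityMeasure_map (μ := bitsLaw q) measurable_rankingOf.aemeasurable
  ((bitsLaw q).map rankingOf).toPMF

lemma toMeasure_instanceLaw (q : Option (Fin m) → unitInterval) :
    (instanceLaw q).toMeasure = (bitsLaw q).map rankingOf := by
  have := Measure.isProbabilityMeasure_map (μ := bitsLaw q) measurable_rankingOf.aemeasurable
  exact Measure.toPMF_toMeasure _

lemma bestRank_singleton (π : Ranking m) (a : Fin m) : bestRank π {a} = rank π a := by
  simp [bestRank]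

lemma win_instanceLaw (q : Option (Fin m) → unitInterval) (hq : (q none : ℝ) = 1 / 2)
    {a b : Fin m} (hab : a ≠ b) :
    win (instanceLaw q) {a} {b} = 1 / 2 + ((q (some a) : ℝ) - q (some b)) / 2 := by
  have h1 : win (instanceLaw q) {a} {b} =
      ∫ π, (if rank π a < rank π b then (1 : ℝ) else 0) ∂(instanceLaw q).toMeasure := by
    rw [PMF.integral_eq_sum]
    refine Finset.sum_congr rfl fun π _ => ?_
    have : rank π a ≠ rank π b := fun h => hab (π.injective (Fin.ext (Nat.succ_injective h)))
    simp [bestRank_singleton, this]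
  have hba : (some b : Option (Fin m)) ≠ some a := fun h => hab (Option.some_injective _ h).symm
  rw [h1, toMeasure_instanceLaw, integral_map measurable_rankingOf.aemeasurable
    (Measurable.of_discrete).aestronglyMeasurable]
  simp only [rank_rankingOf_lt_iff]
  rw [integral_three_bits q (i := none) (j := some a) (k := some b) (by simp) (by simp) hba.symm
    fun r u v => if positionKey a r u < positionKey b r v then 1 else 0]
  have hlt := a.2
  have hlt' := b.2
  have hne : (a : ℕ) ≠ b := fun h => hab (Fin.ext h)
  -- Different qualities decide the comparison; for equal ones (`e3`, `e4`) the fair orientation bit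
  -- does, whatever the indices.
  have e1 : ∀ r, positionKey a r true < positionKey b r false := by
    intro r; cases r <;> simp [positionKey] <;> omega
  have e2 : ∀ r, ¬ positionKey a r false < positionKey b r true := by
    intro r; cases r <;> simp [positionKey] <;> omega
  have e3 : ∀ u, positionKey a true u < positionKey b true u ↔ (a : ℕ) < b := by
    intro u; cases u <;> simp [positionKey]
  have e4 : ∀ u, positionKey a false u < positionKey b false u ↔ ¬ (a : ℕ) < b := by
    intro u; cases u <;> simp [positionKey] <;> omega
  simp only [e1, e2, e3, e4, hq, if_true, if_false]
  by_cases h : (a : ℕ) < b <;> simp only [h, if_true, if_false, not_true_eq_false,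
    not_false_eq_true] <;> ring

/-- All bits unbiased. -/
noncomputable def baseBias (m : ℕ) : Option (Fin m) → unitInterval := fun _ =>
  ⟨1 / 2, by norm_num, by norm_num⟩

/-- All bits unbiased except for the quality of expert `c`. -/
noncomputable def raisedBias (u : unitInterval) (c : Fin m) : Option (Fin m) → unitInterval :=
  Function.update (baseBias m) (some c) u

lemma raisedBias_of_ne (u : unitInterval) {c : Fin m} {i : Option (Fin m)} (h : i ≠ some c) :
    raisedBias u c i = baseBias m i := Function.update_of_ne h _ _

lemma raisedBias_self (u : unitInterval) (c : Fin m) : raisedBias u c (some c) = u :=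
  Function.update_self _ _ _

lemma theta_baseBias (hm : 2 ≤ m) (s : Fin m) : theta (instanceLaw (baseBias m)) {s} = 1 / 2 := by
  have : Nontrivial (Fin m) := Fin.nontrivial_iff_two_le.2 hm
  obtain ⟨x, hx⟩ := exists_ne s
  have : Nonempty {x : Fin m // x ∉ ({s} : Finset (Fin m))} := ⟨⟨x, by simpa using hx⟩⟩
  have : ∀ x : {x : Fin m // x ∉ ({s} : Finset (Fin m))},
      win (instanceLaw (baseBias m)) {s} {(x : Fin m)} = 1 / 2 := by
    intro x
    have hx : s ≠ x := fun h => x.2 (by simp [← h])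
    rw [win_instanceLaw _ rfl hx]
    simp [baseBias]
  simp only [theta, this, ciInf_const]

lemma theta_raisedBias_le (u : unitInterval) {s c : Fin m} (h : s ≠ c) :
    theta (instanceLaw (raisedBias u c)) {s} ≤ 1 / 2 - ((u : ℝ) - 1 / 2) / 2 := by
  have hw := win_instanceLaw (raisedBias u c) (by rw [raisedBias_of_ne _ (by simp)]; rfl) h
  rw [raisedBias_self, raisedBias_of_ne _ (by simpa using h)] at hw
  refine (ciInf_le (Set.finite_range _).bddBelow
    (⟨c, by simpa using h.symm⟩ : {x : Fin m // x ∉ ({s} : Finset (Fin m))})).trans_eq ?_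
  rw [hw]
  simp only [baseBias]
  ring

lemma theta_raisedBias_self (hm : 2 ≤ m) (u : unitInterval) (c : Fin m) :
    theta (instanceLaw (raisedBias u c)) {c} = 1 / 2 + ((u : ℝ) - 1 / 2) / 2 := by
  have : Nontrivial (Fin m) := Fin.nontrivial_iff_two_le.2 hm
  obtain ⟨x, hx⟩ := exists_ne c
  have : Nonempty {x : Fin m // x ∉ ({c} : Finset (Fin m))} := ⟨⟨x, by simpa using hx⟩⟩
  have : ∀ x : {x : Fin m // x ∉ ({c} : Finset (Fin m))},
      win (instanceLaw (raisedBias u c)) {c} {(x : Fin m)} = 1 / 2 + ((u : ℝ) - 1 / 2) / 2 := by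
    intro x
    have hx : c ≠ x := fun h => x.2 (by simp [← h])
    rw [win_instanceLaw _ (by rw [raisedBias_of_ne _ (by simp)]; rfl) hx, raisedBias_self,
      raisedBias_of_ne _ (by simpa using hx.symm)]
    rfl
  simp only [theta, this, ciInf_const]

lemma theta_singleton_le_thetaStar (P : PMF (Ranking m)) (c : Fin m) :
    theta P {c} ≤ thetaStar P 1 :=
  le_ciSup (f := fun S : {S : Finset (Fin m) // S.card = 1} => theta P (S : Finset (Fin m)))
    (Set.finite_range _).bddAbove ⟨{c}, by simp⟩

end Instances

/-! ### From the bits of all tasks to i.i.d. rankings -/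

section Tasks

variable {m : ℕ}

/-- The rankings of all tasks, determined by the bits of all tasks. -/
noncomputable def rankingsOf (β : ℕ × Option (Fin m) → Bool) : ℕ → Ranking m :=
  fun t => rankingOf fun i => β (t, i)

lemma measurable_rankingsOf : Measurable (rankingsOf (m := m)) :=
  measurable_pi_iff.2 fun t => measurable_rankingOf.comp
    (measurable_pi_iff.2 fun i => measurable_pi_apply (t, i))

lemma infinitePi_instanceLaw (q : Option (Fin m) → unitInterval) :
    (Measure.infinitePi fun _ : ℕ => (instanceLaw q).toMeasure) =
      (bitsLaw fun p : ℕ × Option (Fin m) => q p.2).map rankingsOf := by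
  simp only [toMeasure_instanceLaw]
  have h := Measure.infinitePi_map_pi (fun _ : ℕ => bitsLaw q)
    (f := fun _ => rankingOf) (fun _ => measurable_rankingOf)
  have h' := Measure.infinitePi_map_curry (fun (_ : ℕ) (i : Option (Fin m)) => bitLaw (q i))
  rw [← h]
  simp only [bitsLaw]
  have hm : Measurable fun (x : ℕ → Option (Fin m) → Bool) (t : ℕ) => rankingOf (x t) :=
    measurable_pi_iff.2 fun t => measurable_rankingOf.comp (measurable_pi_apply t)
  rw [← h', Measure.map_map hm (MeasurableEquiv.measurable _)]
  rfl

lemma answer_rankingsOf (β : ℕ × Option (Fin m) → Bool) (q : PairQuery m) :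
    answer (rankingsOf β) q =
      decide (positionKey q.2.1.1 (β (q.1, none)) (β (q.1, some q.2.1.1)) <
        positionKey q.2.1.2 (β (q.1, none)) (β (q.1, some q.2.1.2))) := by
  simp only [answer, rankingsOf, rank_rankingOf_lt_iff]

end Tasks

/-! ### Runs as decision trees, and measurability -/

namespace Algorithm

variable {m : ℕ} {Out : Type} [MeasurableSpace Out]

/-- One step of a run: the state consists of the answers received so far and of the number of
queries so far that involve the expert `c`. -/
def step (A : Algorithm m Out) (ω : A.Seed) (π : ℕ → Ranking m) (c : Fin m)
    (s : List Bool × ℕ) : List Bool × ℕ :=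
  match A.act ω s.1 with
  | Sum.inl q => (answer π q :: s.1, s.2 + if q.2.1.1 = c ∨ q.2.1.2 = c then 1 else 0)
  | Sum.inr _ => s

/-- The state of a run after `k` steps. -/
def state (A : Algorithm m Out) (ω : A.Seed) (π : ℕ → Ranking m) (c : Fin m) (k : ℕ) :
    List Bool × ℕ :=
  (A.step ω π c)^[k] ([], 0)

variable (A : Algorithm m Out) (ω : A.Seed) (π : ℕ → Ranking m) (c : Fin m)

lemma state_succ (k : ℕ) : A.state ω π c (k + 1) = A.step ω π c (A.state ω π c k) :=
  Function.iterate_succ_apply' _ _ _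

lemma state_fst (k : ℕ) : (A.state ω π c k).1 = A.history ω π k := by
  induction k with
  | zero => rfl
  | succ k ih =>
    rw [state_succ, history, step, ← ih]
    split <;> simp_all

lemma le_step_snd (s : List Bool × ℕ) : s.2 ≤ (A.step ω π c s).2 := by
  rw [step]
  split <;> simp

lemma le_iterate_step_snd (k : ℕ) (s : List Bool × ℕ) :
    s.2 ≤ ((A.step ω π c)^[k] s).2 := by
  induction k with
  | zero => rfl
  | succ k ih =>
    rw [Function.iterate_succ_apply']
    exact ih.trans (A.le_step_snd ω π c _)

lemma monotone_state_snd : Monotone fun k => (A.state ω π c k).2 :=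
  monotone_nat_of_le_succ fun k => by
    rw [state_succ]
    exact A.le_step_snd ω π c _

/-- Each query names two distinct experts and so is counted twice. -/
lemma sum_state_snd (k : ℕ) :
    ∑ c, (A.state ω π c k).2 = 2 * (A.history ω π k).length := by
  induction k with
  | zero => simp [state, history]
  | succ k ih =>
    simp only [state_succ, step, state_fst, history]
    cases h : A.act ω (A.history ω π k) with
    | inr y => simpa using ih
    | inl q =>
      have hq : ∀ c : Fin m, (if q.2.1.1 = c ∨ q.2.1.2 = c then 1 else 0) =
          (if q.2.1.1 = c then 1 else 0) + if q.2.1.2 = c then 1 else 0 := by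
        intro c
        have := q.2.2
        split_ifs <;> simp_all
      simp only [hq, Finset.sum_add_distrib, ih, Finset.sum_ite_eq, Finset.mem_univ, if_true,
        List.length_cons]
      ring

/-- The bits of all tasks that concern the quality of expert `c`. -/
def qualityBits (c : Fin m) : Set (ℕ × Option (Fin m)) := {p | p.2 = some c}

/-- Here `d` is the remaining budget of queries on `c`. Since the two experts of a query differ, a
query on `c` reads exactly one quality bit of `c`; its other two bits are free. -/
lemma reads_iterate_step {n : ℕ} {Ψ : List Bool × ℕ → ℝ} (hΨ : ∀ s, n < s.2 → Ψ s = 0) (k : ℕ) :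
    ∀ (s : List Bool × ℕ) (d : ℕ), s.2 + d = n →
      Reads (qualityBits c) d fun β => Ψ ((A.step ω (rankingsOf β) c)^[k] s) := by
  induction k with
  | zero => exact fun s d _ => Reads.const d (Ψ s)
  | succ k ih =>
    intro s d hd
    simp only [Function.iterate_succ_apply]
    cases h : A.act ω s.1 with
    | inr y =>
      have hs : ∀ β, A.step ω (rankingsOf β) c s = s := fun β => by simp [step, h]
      simpa only [hs] using ih s d hd
    | inl q =>
      obtain ⟨t, ⟨a, b⟩, hab⟩ := q
      dsimp only at hab
      have hR : (t, none) ∉ qualityBits c := by simp [qualityBits]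
      by_cases ha : a = c
      · subst ha
        have hb : (t, some b) ∉ qualityBits a := by simpa [qualityBits] using hab.symm
        have hs : ∀ β, A.step ω (rankingsOf β) a s =
            (decide (positionKey a (β (t, none)) (β (t, some a)) <
              positionKey b (β (t, none)) (β (t, some b))) :: s.1, s.2 + 1) := fun β => by
          simp [step, h, answer_rankingsOf]
        simp only [hs]
        -- With no budget left this query lifts the count above `n`. Counts never decrease, so `Ψ`
        -- will vanish whatever the answer, and no bit has to be read.
        cases d with
        | zero =>
          have h0 : ∀ (β : ℕ × Option (Fin m) → Bool) (l : List Bool),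
              Ψ ((A.step ω (rankingsOf β) a)^[k] (l, s.2 + 1)) = 0 := fun β l =>
            hΨ _ (lt_of_lt_of_le (by simp; omega) (A.le_iterate_step_snd ω (rankingsOf β) a k _))
          simp only [h0]
          exact Reads.const 0 0
        | succ d =>
          exact Reads.read_paid (i := (t, some a)) (by simp [qualityBits])
            (F := fun u β => Ψ ((A.step ω (rankingsOf β) a)^[k]
              (decide (positionKey a (β (t, none)) u <
                positionKey b (β (t, none)) (β (t, some b))) :: s.1, s.2 + 1)))
            fun u => Reads.read_free hb
              (F := fun v β => Ψ ((A.step ω (rankingsOf β) a)^[k]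
                (decide (positionKey a (β (t, none)) u <
                  positionKey b (β (t, none)) v) :: s.1, s.2 + 1)))
              fun v => Reads.read_free hR
                (F := fun r β => Ψ ((A.step ω (rankingsOf β) a)^[k]
                  (decide (positionKey a r u < positionKey b r v) :: s.1, s.2 + 1)))
                fun r => ih _ d (by dsimp only; omega)
      · have ha' : (t, some a) ∉ qualityBits c := by simpa [qualityBits] using ha
        by_cases hb : b = c
        · subst hb
          have hs : ∀ β, A.step ω (rankingsOf β) b s =
              (decide (positionKey a (β (t, none)) (β (t, some a)) <
                positionKey b (β (t, none)) (β (t, some b))) :: s.1, s.2 + 1) := fun β => by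
            simp [step, h, answer_rankingsOf]
          simp only [hs]
          cases d with
          | zero =>
            have h0 : ∀ (β : ℕ × Option (Fin m) → Bool) (l : List Bool),
                Ψ ((A.step ω (rankingsOf β) b)^[k] (l, s.2 + 1)) = 0 := fun β l =>
              hΨ _ (lt_of_lt_of_le (by simp; omega) (A.le_iterate_step_snd ω (rankingsOf β) b k _))
            simp only [h0]
            exact Reads.const 0 0
          | succ d =>
            exact Reads.read_paid (i := (t, some b)) (by simp [qualityBits])
              (F := fun v β => Ψ ((A.step ω (rankingsOf β) b)^[k]
                (decide (positionKey a (β (t, none)) (β (t, some a)) <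
                  positionKey b (β (t, none)) v) :: s.1, s.2 + 1)))
              fun v => Reads.read_free ha'
                (F := fun u β => Ψ ((A.step ω (rankingsOf β) b)^[k]
                  (decide (positionKey a (β (t, none)) u <
                    positionKey b (β (t, none)) v) :: s.1, s.2 + 1)))
                fun u => Reads.read_free hR
                  (F := fun r β => Ψ ((A.step ω (rankingsOf β) b)^[k]
                    (decide (positionKey a r u < positionKey b r v) :: s.1, s.2 + 1)))
                  fun r => ih _ d (by dsimp only; omega)
        · have hb' : (t, some b) ∉ qualityBits c := by simpa [qualityBits] using hb
          have hs : ∀ β, A.step ω (rankingsOf β) c s =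
              (decide (positionKey a (β (t, none)) (β (t, some a)) <
                positionKey b (β (t, none)) (β (t, some b))) :: s.1, s.2) := fun β => by
            simp [step, h, answer_rankingsOf, ha, hb]
          simp only [hs]
          exact Reads.read_free hb'
            (F := fun v β => Ψ ((A.step ω (rankingsOf β) c)^[k]
              (decide (positionKey a (β (t, none)) (β (t, some a)) <
                positionKey b (β (t, none)) v) :: s.1, s.2)))
            fun v => Reads.read_free ha'
              (F := fun u β => Ψ ((A.step ω (rankingsOf β) c)^[k]
                (decide (positionKey a (β (t, none)) u <
                  positionKey b (β (t, none)) v) :: s.1, s.2)))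
              fun u => Reads.read_free hR
                (F := fun r β => Ψ ((A.step ω (rankingsOf β) c)^[k]
                  (decide (positionKey a r u < positionKey b r v) :: s.1, s.2)))
                fun r => ih _ d hd

/-- States form a countable type, so measurability reduces to single states, one step at a time. -/
lemma measurableSet_state_eq (k : ℕ) : ∀ s : List Bool × ℕ,
    MeasurableSet {z : A.Seed × (ℕ → Ranking m) | A.state z.1 z.2 c k = s} := by
  have hinr : ∀ h : List Bool, MeasurableSet
      {z : A.Seed × (ℕ → Ranking m) | A.act z.1 h ∈ Set.range Sum.inr} := fun h =>
    ((A.measurable_act h).comp measurable_fst) measurableSet_range_inr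
  have hinl : ∀ (h : List Bool) (q : PairQuery m), MeasurableSet
      {z : A.Seed × (ℕ → Ranking m) | A.act z.1 h ∈ Sum.inl '' {q}} := fun h q =>
    ((A.measurable_act h).comp measurable_fst)
      (measurableSet_inl_image.2 (measurableSet_singleton q))
  have hstep : ∀ s' s : List Bool × ℕ, MeasurableSet
      {z : A.Seed × (ℕ → Ranking m) | A.step z.1 z.2 c s' = s} := by
    intro s' s
    have : {z : A.Seed × (ℕ → Ranking m) | A.step z.1 z.2 c s' = s} =
        ({z | A.act z.1 s'.1 ∈ Set.range Sum.inr} ∩ {_z | s' = s}) ∪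
        ⋃ q : PairQuery m, {z | A.act z.1 s'.1 ∈ Sum.inl '' {q}} ∩
          {z | (answer z.2 q :: s'.1,
            s'.2 + if q.2.1.1 = c ∨ q.2.1.2 = c then 1 else 0) = s} := by
      ext z
      simp only [Set.mem_ofPred_eq, step, Set.mem_union, Set.mem_inter_iff, Set.mem_iUnion]
      cases h : A.act z.1 s'.1 <;> simp
    rw [this]
    refine ((hinr _).inter (MeasurableSet.const _)).union
      (MeasurableSet.iUnion fun q => (hinl _ q).inter ?_)
    have hans : Measurable fun z : A.Seed × (ℕ → Ranking m) => z.2 q.1 :=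
      (measurable_pi_apply q.1).comp measurable_snd
    exact hans (MeasurableSet.of_discrete (s := {ρ : Ranking m |
      (decide (rank ρ q.2.1.1 < rank ρ q.2.1.2) :: s'.1,
        s'.2 + if q.2.1.1 = c ∨ q.2.1.2 = c then 1 else 0) = s}))
  induction k with
  | zero => exact fun s => MeasurableSet.const (([], 0) = s)
  | succ k ih =>
    intro s
    have : {z : A.Seed × (ℕ → Ranking m) | A.state z.1 z.2 c (k + 1) = s} =
        ⋃ s', {z | A.state z.1 z.2 c k = s'} ∩ {z | A.step z.1 z.2 c s' = s} := by
      ext z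
      simp [state_succ]
    rw [this]
    exact MeasurableSet.iUnion fun s' => (ih s').inter (hstep s' s)

lemma measurable_comp_state (k : ℕ) (f : List Bool × ℕ → ℕ) :
    Measurable fun z : A.Seed × (ℕ → Ranking m) => f (A.state z.1 z.2 c k) := by
  refine measurable_to_countable' fun j => ?_
  have : (fun z : A.Seed × (ℕ → Ranking m) => f (A.state z.1 z.2 c k)) ⁻¹' {j} =
      ⋃ s : {s // f s = j}, {z | A.state z.1 z.2 c k = s} := by
    ext z
    simp
  rw [this]
  exact MeasurableSet.iUnion fun s => A.measurableSet_state_eq c k _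

/-- The event that the algorithm has stopped within `k` steps and returned an element of `G`. -/
def returnedBy (G : Set Out) (k : ℕ) : Set (A.Seed × (ℕ → Ranking m)) :=
  {z | A.act z.1 (A.history z.1 z.2 k) ∈ Sum.inr '' G}

lemma measurableSet_returnedBy {G : Set Out} (hG : MeasurableSet G) (c : Fin m) (k : ℕ) :
    MeasurableSet (A.returnedBy G k) := by
  have : A.returnedBy G k = ⋃ s : List Bool × ℕ, {z | A.state z.1 z.2 c k = s} ∩
      {z | A.act z.1 s.1 ∈ Sum.inr '' G} := by
    ext z
    simp [returnedBy, ← state_fst _ _ _ c]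
  rw [this]
  exact MeasurableSet.iUnion fun s => (A.measurableSet_state_eq c k s).inter
    (((A.measurable_act s.1).comp measurable_fst) (measurableSet_inr_image.2 hG))

lemma monotone_returnedBy (G : Set Out) : Monotone (A.returnedBy G) := by
  refine monotone_nat_of_le_succ fun k z hz => ?_
  obtain ⟨y, hy, h⟩ := hz
  refine ⟨y, hy, ?_⟩
  simp only [history, ← h]

lemma setOf_returns_eq_iUnion (G : Set Out) :
    {z : A.Seed × (ℕ → Ranking m) | ∃ y ∈ G, A.Returns z.1 z.2 y} = ⋃ k, A.returnedBy G k := by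
  ext z
  simp only [Returns, returnedBy, Set.mem_ofPred_eq, Set.mem_iUnion, Set.mem_image]
  constructor
  · rintro ⟨y, hy, n, h⟩
    exact ⟨n, y, hy, h.symm⟩
  · rintro ⟨n, y, hy, h⟩
    exact ⟨y, hy, n, h.symm⟩

end Algorithm

/-! ### Comparing success probabilities on the two instances -/

namespace Algorithm

variable {m : ℕ} {Out : Type} [MeasurableSpace Out] (A : Algorithm m Out)

instance isProbabilityMeasure_runLaw (P : PMF (Ranking m)) :
    IsProbabilityMeasure (A.runLaw P) := by
  unfold runLaw; infer_instance

/-- The number of queries of a run that involve the expert `c`. -/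
noncomputable def numQueriesOn (c : Fin m) (z : A.Seed × (ℕ → Ranking m)) : ℝ≥0∞ :=
  ⨆ k, ((A.state z.1 z.2 c k).2 : ℝ≥0∞)

lemma measurable_numQueriesOn (c : Fin m) : Measurable (A.numQueriesOn c) :=
  Measurable.iSup fun k => measurable_from_top.comp (A.measurable_comp_state c k Prod.snd)

lemma sum_numQueriesOn (z : A.Seed × (ℕ → Ranking m)) :
    ∑ c, A.numQueriesOn c z = 2 * A.numQueries z.1 z.2 := by
  simp only [numQueriesOn, numQueries]
  rw [ENNReal.finsetSum_iSup_of_monotone fun c i j h =>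
    Nat.cast_le.2 (A.monotone_state_snd z.1 z.2 c h), ENNReal.mul_iSup]
  refine iSup_congr fun k => ?_
  rw [← Nat.cast_sum, sum_state_snd]
  simp

lemma measurable_numQueries (c : Fin m) :
    Measurable fun z : A.Seed × (ℕ → Ranking m) => A.numQueries z.1 z.2 := by
  refine Measurable.iSup fun k => ?_
  simp only [← A.state_fst _ _ c]
  exact measurable_from_top.comp (A.measurable_comp_state c k fun s => s.1.length)

lemma runLaw_instanceLaw_apply (q : Option (Fin m) → unitInterval)
    {T : Set (A.Seed × (ℕ → Ranking m))} (hT : MeasurableSet T) :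
    A.runLaw (instanceLaw q) T = ∫⁻ ω, bitsLaw (fun p : ℕ × Option (Fin m) => q p.2)
      {β | (ω, rankingsOf β) ∈ T} ∂A.seedLaw := by
  rw [runLaw, infinitePi_instanceLaw]
  rw [Measure.prod_apply hT]
  refine lintegral_congr fun ω => ?_
  rw [Measure.map_apply measurable_rankingsOf (measurable_prodMk_left hT)]
  rfl

/-- Events decided after at most `n` queries involving `c` hardly depend on the quality of `c`. -/
lemma runLaw_returnedBy_inter_le {G : Set Out} (hG : MeasurableSet G) (c : Fin m)
    {u : unitInterval} {δ : ℝ} (hu : (u : ℝ) = 1 / 2 + δ) {n : ℕ}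
    (hn : (1 + 4 * δ ^ 2) ^ n ≤ 201 / 200) (k : ℕ) :
    A.runLaw (instanceLaw (baseBias m))
        (A.returnedBy G k ∩ {z | (A.state z.1 z.2 c k).2 ≤ n}) ≤
      A.runLaw (instanceLaw (raisedBias u c)) (A.returnedBy G k) + ENNReal.ofReal (1 / 12) := by
  classical
  have hT : MeasurableSet (A.returnedBy G k ∩ {z | (A.state z.1 z.2 c k).2 ≤ n}) :=
    (A.measurableSet_returnedBy hG c k).inter
      (A.measurable_comp_state c k Prod.snd (MeasurableSet.of_discrete (s := Set.Iic n)))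
  refine le_trans ?_ (add_le_add_left (measure_mono
    (Set.inter_subset_left (t := {z | (A.state z.1 z.2 c k).2 ≤ n}))) _)
  rw [A.runLaw_instanceLaw_apply _ hT, A.runLaw_instanceLaw_apply _ hT]
  have hadd : ∀ F : A.Seed → ℝ≥0∞, ∫⁻ ω, F ω ∂A.seedLaw + ENNReal.ofReal (1 / 12) =
      ∫⁻ ω, (F ω + ENNReal.ofReal (1 / 12)) ∂A.seedLaw := fun F => by
    rw [lintegral_add_right _ measurable_const]; simp
  rw [hadd]
  refine lintegral_mono fun ω => ?_
  -- The seed is now fixed, so the event is a deterministic function of the bits. The count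
  -- condition inside `Ψ` bounds the number of biased reads by `n`.
  set Ψ : List Bool × ℕ → ℝ := fun s =>
    if A.act ω s.1 ∈ Sum.inr '' G ∧ s.2 ≤ n then 1 else 0 with hΨ
  have hreads := A.reads_iterate_step ω c (n := n) (Ψ := Ψ)
    (fun s hs => by simp [hΨ, hs.not_ge]) k ([], 0) n (by simp)
  have hle := hreads.integral_le_add
    (fun β => by simp only [hΨ]; split_ifs <;> simp)
    (q := fun p => raisedBias u c p.2) (q₀ := fun p => baseBias m p.2)
    (fun p hp => raisedBias_of_ne u hp) (fun p _ => rfl)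
    (fun p hp => by
      have hp : p.2 = some c := hp
      rw [hp, raisedBias_self, hu]) hn
  have hset : ∀ q : ℕ × Option (Fin m) → unitInterval,
      bitsLaw q {β | (ω, rankingsOf β) ∈
        A.returnedBy G k ∩ {z | (A.state z.1 z.2 c k).2 ≤ n}} =
      ENNReal.ofReal (∫ β, Ψ ((A.step ω (rankingsOf β) c)^[k] ([], 0)) ∂bitsLaw q) := by
    intro q
    have hmeas : MeasurableSet {β : ℕ × Option (Fin m) → Bool | (ω, rankingsOf β) ∈
        A.returnedBy G k ∩ {z | (A.state z.1 z.2 c k).2 ≤ n}} :=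
      (measurable_const.prodMk measurable_rankingsOf) hT
    rw [← ofReal_measureReal, ← integral_indicator_one hmeas]
    congr 1
    refine integral_congr_ae (Filter.Eventually.of_forall fun β => ?_)
    simp only [Set.indicator_apply, hΨ, Set.mem_ofPred_eq, Set.mem_inter_iff, returnedBy,
      ← A.state_fst _ _ c, state, Pi.one_apply]
  rw [hset, hset, ← ENNReal.ofReal_add (integral_nonneg fun β => by
    simp only [hΨ]; split_ifs <;> simp) (by norm_num)]
  exact ENNReal.ofReal_le_ofReal hle

/-- Runs with at most `n` queries on `c` are transferred to the raised instance, at a cost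
independent of the number of steps `k`; Markov's inequality bounds the others. -/
lemma successProb_baseBias_le {G : Set Out} (hG : MeasurableSet G) (c : Fin m)
    {u : unitInterval} {δ : ℝ} (hu : (u : ℝ) = 1 / 2 + δ) {n : ℕ}
    (hn : (1 + 4 * δ ^ 2) ^ n ≤ 201 / 200) :
    A.successProb (instanceLaw (baseBias m)) G ≤
      A.successProb (instanceLaw (raisedBias u c)) G + ENNReal.ofReal (1 / 12) +
        (∫⁻ z, A.numQueriesOn c z ∂A.runLaw (instanceLaw (baseBias m))) / ((n : ℝ≥0∞) + 1) := by
  simp only [successProb, setOf_returns_eq_iUnion]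
  rw [(A.monotone_returnedBy G).measure_iUnion]
  refine iSup_le fun k => ?_
  have hsub : A.returnedBy G k ⊆ (A.returnedBy G k ∩ {z | (A.state z.1 z.2 c k).2 ≤ n}) ∪
      {z | (n : ℝ≥0∞) + 1 ≤ A.numQueriesOn c z} := by
    intro z hz
    by_cases h : (A.state z.1 z.2 c k).2 ≤ n
    · exact Or.inl ⟨hz, h⟩
    · have hk : (n : ℝ≥0∞) + 1 ≤ (A.state z.1 z.2 c k).2 := by
        exact_mod_cast Nat.succ_le_of_lt (not_le.1 h)
      exact Or.inr (hk.trans (le_iSup (fun k => ((A.state z.1 z.2 c k).2 : ℝ≥0∞)) k))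
  refine (measure_mono hsub).trans ((measure_union_le _ _).trans (add_le_add ?_ ?_))
  · refine (A.runLaw_returnedBy_inter_le hG c hu hn k).trans (add_le_add_left (measure_mono ?_) _)
    exact Set.subset_iUnion _ k
  · exact meas_ge_le_lintegral_div (A.measurable_numQueriesOn c).aemeasurable (by simp) (by simp)

lemma successProb_add_le_one [Nonempty (Fin m)] (P : PMF (Ranking m)) {G G' : Set Out}
    (hG : MeasurableSet G) (hGG' : Disjoint G G') :
    A.successProb P G + A.successProb P G' ≤ 1 := by
  obtain ⟨c⟩ := ‹Nonempty (Fin m)›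
  simp only [successProb, setOf_returns_eq_iUnion]
  rw [← measure_union' ?_ (MeasurableSet.iUnion fun k => A.measurableSet_returnedBy hG c k)]
  · exact prob_le_one
  · rw [Set.disjoint_left]
    intro z hz hz'
    obtain ⟨k, hk⟩ := Set.mem_iUnion.1 hz
    obtain ⟨k', hk'⟩ := Set.mem_iUnion.1 hz'
    obtain ⟨y, hy, h⟩ := A.monotone_returnedBy G (le_max_left k k') hk
    obtain ⟨y', hy', h'⟩ := A.monotone_returnedBy G' (le_max_right k k') hk'
    have : y = y' := Sum.inr_injective (h.trans h'.symm)
    exact Set.disjoint_left.1 hGG' hy (this ▸ hy')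

lemma successProb_ne_top (P : PMF (Ranking m)) (G : Set Out) : A.successProb P G ≠ ∞ :=
  measure_ne_top _ _

lemma toReal_successProb_add_le_one [Nonempty (Fin m)] (P : PMF (Ranking m)) {G G' : Set Out}
    (hG : MeasurableSet G) (hGG' : Disjoint G G') :
    (A.successProb P G).toReal + (A.successProb P G').toReal ≤ 1 := by
  rw [← ENNReal.toReal_add (A.successProb_ne_top _ _) (A.successProb_ne_top _ _)]
  exact ENNReal.toReal_le_of_le_ofReal zero_le_one
    (by simpa using A.successProb_add_le_one P hG hGG')

lemma toReal_successProb_of_two_thirds_le {P : PMF (Ranking m)} {G : Set Out}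
    (h : 2 / 3 ≤ A.successProb P G) : 2 / 3 ≤ (A.successProb P G).toReal := by
  have := ENNReal.toReal_mono (A.successProb_ne_top _ _) h
  simpa using this

lemma length_history_of_not_returns {ω : A.Seed} {π : ℕ → Ranking m}
    (h : ∀ y, ¬ A.Returns ω π y) (k : ℕ) : (A.history ω π k).length = k := by
  induction k with
  | zero => rfl
  | succ k ih =>
    rw [history]
    cases hk : A.act ω (A.history ω π k) with
    | inl q => simp [ih]
    | inr y => exact absurd ⟨k, hk⟩ (h y)

/-- An algorithm with finite expected number of queries stops almost surely. -/
lemma successProb_univ [Nonempty (Fin m)] {P : PMF (Ranking m)} (h : A.expectedQueries P ≠ ∞) :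
    A.successProb P Set.univ = 1 := by
  obtain ⟨c⟩ := ‹Nonempty (Fin m)›
  have hlt := ae_lt_top (A.measurable_numQueries c) h
  refine (prob_compl_eq_zero_iff ?_).1 ?_
  · rw [setOf_returns_eq_iUnion]
    exact MeasurableSet.iUnion fun k => A.measurableSet_returnedBy MeasurableSet.univ c k
  · refine measure_mono_null (fun z hz => ?_) hlt
    have hz' : ∀ y, ¬ A.Returns z.1 z.2 y := fun y hy => hz ⟨y, Set.mem_univ y, hy⟩
    simp only [Set.mem_compl_iff, Set.mem_ofPred_eq, numQueries,
      A.length_history_of_not_returns hz', ENNReal.iSup_natCast, lt_self_iff_false,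
      not_false_eq_true]

lemma one_le_toReal_successProb_add_compl [Nonempty (Fin m)] {P : PMF (Ranking m)}
    (h : A.expectedQueries P ≠ ∞) (G : Set Out) :
    1 ≤ (A.successProb P G).toReal + (A.successProb P Gᶜ).toReal := by
  rw [← ENNReal.toReal_add (A.successProb_ne_top _ _) (A.successProb_ne_top _ _)]
  refine (ENNReal.ofReal_le_iff_le_toReal
    (ENNReal.add_ne_top.2 ⟨A.successProb_ne_top _ _, A.successProb_ne_top _ _⟩)).1 ?_
  rw [ENNReal.ofReal_one, ← A.successProb_univ h]
  refine (measure_mono fun z hz => ?_).trans (measure_union_le _ _)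
  obtain ⟨y, -, hy⟩ := hz
  by_cases hG : y ∈ G
  · exact Or.inl ⟨y, hG, hy⟩
  · exact Or.inr ⟨y, hG, hy⟩

end Algorithm

/-! ### Constants and the expected number of queries -/

lemma one_add_pow_le_of_mul_le {t : ℝ} (ht : 0 ≤ t) {n : ℕ} (h : n * t ≤ 1 / 250) :
    (1 + t) ^ n ≤ 201 / 200 := by
  have h1 : (1 + t) ^ n ≤ Real.exp (n * t) := by
    rw [Real.exp_nat_mul]
    exact pow_le_pow_left₀ (by positivity) (by linarith [Real.add_one_le_exp t]) n
  have h2 : Real.exp (n * t) ≤ Real.exp (1 / 250) := Real.exp_le_exp.2 h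
  have h3 := Real.one_sub_le_exp_neg (1 / 250)
  rw [Real.exp_neg] at h3
  have h4 := Real.exp_pos (1 / 250)
  have h5 : Real.exp (1 / 250) * (Real.exp (1 / 250))⁻¹ = 1 := mul_inv_cancel₀ h4.ne'
  nlinarith

/-- The success probability `1 / 2 + 5 ε` of the quality bit of the distinguished expert. -/
noncomputable def raisedProb (ε : ℝ) (hε : 0 < ε) (hε' : ε ≤ 1 / 16) : unitInterval :=
  ⟨1 / 2 + 5 * ε, by linarith, by linarith⟩

namespace Algorithm

variable {m : ℕ} {Out : Type} [MeasurableSpace Out] (A : Algorithm m Out)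

lemma le_lintegral_numQueriesOn {ε : ℝ} (hε : 0 < ε) (hε' : ε ≤ 1 / 16) {c : Fin m} {G : Set Out}
    (hG : MeasurableSet G)
    (h₀ : 1 / 2 ≤ (A.successProb (instanceLaw (baseBias m)) G).toReal)
    (h₁ : (A.successProb (instanceLaw (raisedBias (raisedProb ε hε hε') c)) G).toReal ≤ 1 / 3) :
    ENNReal.ofReal (1 / (300000 * ε ^ 2)) ≤
      ∫⁻ z, A.numQueriesOn c z ∂A.runLaw (instanceLaw (baseBias m)) := by
  -- With `δ = 5ε` one has `4δ² = 100ε²`, and this `n` makes `n * 100ε² ≤ 1/250`, as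
  -- `one_add_pow_le_of_mul_le` requires.
  set n := ⌊1 / (25000 * ε ^ 2)⌋₊ with hn
  have hε2 : 0 < 25000 * ε ^ 2 := by positivity
  have hpow : (1 + 4 * (5 * ε) ^ 2) ^ n ≤ 201 / 200 := by
    refine one_add_pow_le_of_mul_le (by positivity) ?_
    have := Nat.floor_le (show 0 ≤ 1 / (25000 * ε ^ 2) by positivity)
    rw [← hn, le_div_iff₀ hε2] at this
    linarith
  have hmain := A.successProb_baseBias_le hG c (u := raisedProb ε hε hε') (δ := 5 * ε) rfl hpow
  set H := ∫⁻ z, A.numQueriesOn c z ∂A.runLaw (instanceLaw (baseBias m))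
  by_cases hH : H = ∞
  · rw [hH]; exact le_top
  have hfin : H / ((n : ℝ≥0∞) + 1) ≠ ∞ := ENNReal.div_ne_top hH (by simp)
  have hreal := ENNReal.toReal_mono (ENNReal.add_ne_top.2
    ⟨ENNReal.add_ne_top.2 ⟨A.successProb_ne_top _ _, ENNReal.ofReal_ne_top⟩, hfin⟩) hmain
  rw [ENNReal.toReal_add (ENNReal.add_ne_top.2 ⟨A.successProb_ne_top _ _, ENNReal.ofReal_ne_top⟩) hfin,
    ENNReal.toReal_add (A.successProb_ne_top _ _) ENNReal.ofReal_ne_top,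
    ENNReal.toReal_ofReal (by norm_num), ENNReal.toReal_div] at hreal
  have hn1 : ((n : ℝ≥0∞) + 1).toReal = (n : ℝ) + 1 := by
    rw [ENNReal.toReal_add (by simp) (by simp)]; simp
  rw [hn1] at hreal
  have hfloor := Nat.lt_floor_add_one (1 / (25000 * ε ^ 2))
  rw [← hn] at hfloor
  -- `1/2 - 1/3 - 1/12 = 1/12`.
  have hdiv : 1 / 12 ≤ H.toReal / ((n : ℝ) + 1) := by linarith
  rw [le_div_iff₀ (by positivity)] at hdiv
  rw [ENNReal.ofReal_le_iff_le_toReal hH]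
  have he : 1 / (300000 * ε ^ 2) = 1 / 12 * (1 / (25000 * ε ^ 2)) := by
    field_simp; norm_num
  rw [he]
  linarith

lemma le_expectedQueries_baseBias {ε : ℝ} (hε : 0 < ε) (hε' : ε ≤ 1 / 16) (c₀ : Fin m)
    {G : Fin m → Set Out} (hG : ∀ c, MeasurableSet (G c))
    (h₀ : ∀ c ≠ c₀, 1 / 2 ≤ (A.successProb (instanceLaw (baseBias m)) (G c)).toReal)
    (h₁ : ∀ c ≠ c₀, (A.successProb
      (instanceLaw (raisedBias (raisedProb ε hε hε') c)) (G c)).toReal ≤ 1 / 3) :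
    ENNReal.ofReal (1 / 600000 * (((m : ℝ) - 1) / ε ^ 2)) ≤
      A.expectedQueries (instanceLaw (baseBias m)) := by
  have hsum : 2 * A.expectedQueries (instanceLaw (baseBias m)) =
      ∑ c, ∫⁻ z, A.numQueriesOn c z ∂A.runLaw (instanceLaw (baseBias m)) := by
    rw [← lintegral_finsetSum _ fun c _ => A.measurable_numQueriesOn c]
    simp only [sum_numQueriesOn]
    rw [lintegral_const_mul _ (A.measurable_numQueries c₀), expectedQueries]
  have hcard : ((Finset.univ.erase c₀).card : ℝ) = (m : ℝ) - 1 := by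
    rw [Finset.card_erase_of_mem (Finset.mem_univ _), Finset.card_univ, Fintype.card_fin,
      Nat.cast_sub (Nat.succ_le_of_lt c₀.pos)]
    simp
  have hle : ((Finset.univ.erase c₀).card : ℝ≥0∞) * ENNReal.ofReal (1 / (300000 * ε ^ 2)) ≤
      2 * A.expectedQueries (instanceLaw (baseBias m)) := by
    rw [hsum, ← nsmul_eq_mul, ← Finset.sum_const]
    refine le_trans (Finset.sum_le_sum fun c hc => ?_)
      (Finset.sum_le_sum_of_subset (Finset.erase_subset c₀ _))
    have hc := Finset.ne_of_mem_erase hc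
    exact A.le_lintegral_numQueriesOn hε hε' (hG c) (h₀ c hc) (h₁ c hc)
  have h2 : 2 * ENNReal.ofReal (1 / 600000 * (((m : ℝ) - 1) / ε ^ 2)) =
      ((Finset.univ.erase c₀).card : ℝ≥0∞) * ENNReal.ofReal (1 / (300000 * ε ^ 2)) := by
    rw [← ENNReal.ofReal_natCast (Finset.univ.erase c₀).card, hcard,
      ← ENNReal.ofReal_ofNat 2, ← ENNReal.ofReal_mul (by norm_num), ← ENNReal.ofReal_mul
        (by rw [← hcard]; positivity)]
    congr 1
    field_simp
    ring
  rw [← h2] at hle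
  exact (ENNReal.mul_le_mul_iff_right (by simp) (by simp)).1 hle

lemma expectedQueries_le_worstCase (P : PMF (Ranking m)) :
    A.expectedQueries P ≤ A.worstCaseExpectedQueries :=
  le_iSup A.expectedQueries P

end Algorithm

end PairwiseFeedback

/-! ### The two lower bounds -/

open PairwiseFeedback in
theorem theorem5p5 :
    (∃ κ : ℝ, 0 < κ ∧ ∀ m : ℕ, 2 ≤ m → ∀ ε : ℝ, 0 < ε → ε ≤ 1 / 16 →
      ∀ s : Fin m, ∀ A : PairwiseFeedback.Algorithm m ℝ,
        (∀ P : PMF (PairwiseFeedback.Ranking m),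
          2 / 3 ≤ A.successProb P {y : ℝ | |y - PairwiseFeedback.theta P {s}| ≤ ε}) →
        ENNReal.ofReal (κ * (((m : ℝ) - 1) / ε ^ 2)) ≤ A.worstCaseExpectedQueries) ∧
    (∃ κ : ℝ, 0 < κ ∧ ∀ m : ℕ, 2 ≤ m → ∀ ε : ℝ, 0 < ε → ε ≤ 1 / 16 →
      ∀ A : PairwiseFeedback.Algorithm m (Fin m),
        (∀ P : PMF (PairwiseFeedback.Ranking m),
          2 / 3 ≤ A.successProb P
            {c : Fin m | PairwiseFeedback.theta P {c} ≥ PairwiseFeedback.thetaStar P 1 - ε}) →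
        ENNReal.ofReal (κ * ((m : ℝ) / ε ^ 2)) ≤ A.worstCaseExpectedQueries) := by
  refine ⟨⟨1 / 600000, by norm_num, fun m hm ε hε hε' s A hA => ?_⟩,
    ⟨1 / 1200000, by norm_num, fun m hm ε hε hε' A hA => ?_⟩⟩
  · have : Nonempty (Fin m) := ⟨s⟩
    have hmeas : ∀ x : ℝ, MeasurableSet {y : ℝ | |y - x| ≤ ε} := fun x =>
      measurableSet_le (by fun_prop) measurable_const
    refine le_trans (A.le_expectedQueries_baseBias hε hε' s
      (G := fun _ => {y : ℝ | |y - 1 / 2| ≤ ε}) (fun _ => hmeas _) (fun c hc => ?_)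
      (fun c hc => ?_)) (A.expectedQueries_le_worstCase _)
    · have h := A.toReal_successProb_of_two_thirds_le (hA (instanceLaw (baseBias m)))
      rw [theta_baseBias hm] at h
      linarith
    · set P := instanceLaw (raisedBias (raisedProb ε hε hε') c)
      have h := A.toReal_successProb_of_two_thirds_le (hA P)
      have hθ : theta P {s} ≤ 1 / 2 - (1 / 2 + 5 * ε - 1 / 2) / 2 :=
        theta_raisedBias_le (raisedProb ε hε hε') hc.symm
      -- The two values of `θ` differ by at least `5ε/2 > 2ε`, so no estimate is accurate for both.
      have hdisj : Disjoint {y : ℝ | |y - 1 / 2| ≤ ε} {y : ℝ | |y - theta P {s}| ≤ ε} := by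
        rw [Set.disjoint_left]
        intro y hy hy'
        have h1 := abs_le.1 (show |y - 1 / 2| ≤ ε from hy)
        have h2 := abs_le.1 (show |y - theta P {s}| ≤ ε from hy')
        linarith [h1.1, h2.2]
      have := A.toReal_successProb_add_le_one P (hmeas (1 / 2)) hdisj
      linarith
  · have : Nonempty (Fin m) := ⟨⟨0, by omega⟩⟩
    have hm' : (2 : ℝ) ≤ m := by exact_mod_cast hm
    refine le_trans ?_ (A.expectedQueries_le_worstCase (instanceLaw (baseBias m)))
    -- A finite expectation forces almost sure stopping; only then does not returning `c` mean
    -- returning some other expert.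
    by_cases hfin : A.expectedQueries (instanceLaw (baseBias m)) = ∞
    · rw [hfin]; exact le_top
    -- Two distinct outputs cannot both have probability above `1/2`.
    have hmost : ∃ c₀ : Fin m, ∀ c ≠ c₀,
        (A.successProb (instanceLaw (baseBias m)) {c}).toReal ≤ 1 / 2 := by
      by_cases h : ∃ c₀, 1 / 2 < (A.successProb (instanceLaw (baseBias m)) {c₀}).toReal
      · obtain ⟨c₀, hc₀⟩ := h
        refine ⟨c₀, fun c hc => ?_⟩
        have := A.toReal_successProb_add_le_one (instanceLaw (baseBias m))
          (measurableSet_singleton c) (Set.disjoint_singleton.2 hc)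
        linarith
      · push Not at h
        exact ⟨Classical.arbitrary _, fun c _ => h c⟩
    obtain ⟨c₀, hc₀⟩ := hmost
    refine le_trans (ENNReal.ofReal_le_ofReal ?_) (A.le_expectedQueries_baseBias hε hε' c₀
      (G := fun c => {c}ᶜ) (fun c => (measurableSet_singleton c).compl) (fun c hc => ?_)
      (fun c _ => ?_))
    -- `m ≤ 2(m - 1)` for `m ≥ 2`, which accounts for the halved constant.
    · rw [mul_div_assoc', mul_div_assoc']
      exact div_le_div_of_nonneg_right (by linarith) (by positivity)
    · have := A.one_le_toReal_successProb_add_compl hfin {c}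
      linarith [hc₀ c hc]
    · set P := instanceLaw (raisedBias (raisedProb ε hε hε') c)
      -- On the raised instance `c` leads every other expert by at least `5ε > ε`, so it is the only
      -- admissible output.
      have hsub : {x : Fin m | theta P {x} ≥ thetaStar P 1 - ε} ⊆ {c} := by
        intro x hx
        by_contra hxc
        have h1 : theta P {x} ≤ 1 / 2 - (1 / 2 + 5 * ε - 1 / 2) / 2 :=
          theta_raisedBias_le (raisedProb ε hε hε') hxc
        have h2 : theta P {c} = 1 / 2 + (1 / 2 + 5 * ε - 1 / 2) / 2 :=
          theta_raisedBias_self hm (raisedProb ε hε hε') c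
        have h3 := theta_singleton_le_thetaStar P c
        have hx : theta P {x} ≥ thetaStar P 1 - ε := hx
        linarith
      have h := A.toReal_successProb_of_two_thirds_le (hA P)
      have := A.toReal_successProb_add_le_one P (MeasurableSet.of_discrete)
        (disjoint_compl_right.mono_left hsub)
      linarith
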